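/- Proposition 4.6. Let $E$ be an Archimedean vector lattice over $\mathbb{R}$, and let $(E^{\mu_{2,4}},\phi)$ be its square mean completion. Then $E$ (identified with $\phi(E)$) is relatively uniformly dense in $E^{\mu_{2,4}}$: for every $f\in E^{\mu_{2,4}}$ there are a sequence $(f_n)$ in $\phi(E)$ and an element $u\ge 0$ of $E^{\mu_{2,4}}$ such that for every $\varepsilon>0$ there is an $N$ with $|f_n-f|\le\varepsilon u$ for all $n\ge N$. Here, for elements $f,g$ of an Archimedean real vector lattice $F$, the square mean is $\mu_{2,4}(f,g)=\frac{1}{\sqrt2}\sup\{f\cos\theta+g\sin\theta:\theta\in[0,2\pi]\}$, whenever this supremum exists in $F$, and $F$ is called square mean complete if it exists for all $f,g\in F$. A square mean completion of $E$ is a pair $(E^{\mu_{2,4}},\phi)$ consisting of a square mean complete Archimedean real vector lattice $E^{\mu_{2,4}}$ and an injective vector lattice homomorphism $\phi:E\to E^{\mu_{2,4}}$ such that for every square mean complete Archimedean real vector lattice $F$ and every vector lattice homomorphism $T:E\to F$ there is a unique vector lattice homomorphism $S:E^{\mu_{2,4}}\to F$ with $S\circ\phi=T$. It exists and is unique up to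 isomorphism. -/

import Mathlib

/-! Real vector lattices are carried by the Mathlib classes `AddCommGroup`, `Lattice`,
`IsOrderedAddMonoid`, `Module ℝ`, `IsOrderedModule ℝ`. -/

universe u

namespace VectorLattice

/-- The Archimedean property of vector lattices: if `n|f| ≤ |g|` for every `n`, then `f = 0`.
(This is not Mathlib's `Archimedean`, which would make every strictly positive element a strong
order unit.) -/
def IsArchimedean (E : Type*) [AddCommGroup E] [Lattice E] : Prop :=
  ∀ f g : E, (∀ n : ℕ, n • |f| ≤ |g|) → f = 0

/-- A vector lattice homomorphism: a linear map that preserves absolute values. -/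
def IsVectorLatticeHom {E F : Type*} [AddCommGroup E] [Lattice E] [Module ℝ E]
    [AddCommGroup F] [Lattice F] [Module ℝ F] (T : E →ₗ[ℝ] F) : Prop :=
  ∀ f : E, T |f| = |T f|

/-- `k = f ⊞ g`, i.e. the supremum of `f cos θ + g sin θ` over `θ ∈ [0, 2π]` exists and is `k`. -/
def IsBoxPlus {E : Type*} [AddCommGroup E] [Lattice E] [Module ℝ E] (f g k : E) : Prop :=
  IsLUB ((fun θ : ℝ => Real.cos θ • f + Real.sin θ • g) '' Set.Icc 0 (2 * Real.pi)) k

/-- `h = μ_{2,4}(f, g)`: the square mean of `f` and `g` exists in `E`, that is `f ⊞ g` exists,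
and it equals `h = (1/√2) (f ⊞ g)`. -/
def IsSquareMean {E : Type*} [AddCommGroup E] [Lattice E] [Module ℝ E] (f g h : E) : Prop :=
  ∃ k : E, IsBoxPlus f g k ∧ h = (1 / Real.sqrt 2) • k

/-- Square mean completeness (`μ_{2,4}`-completeness): any two elements have a square mean. -/
def IsSquareMeanComplete (E : Type*) [AddCommGroup E] [Lattice E] [Module ℝ E] : Prop :=
  ∀ f g : E, ∃ h : E, IsSquareMean f g h

/-- `(H, φ)` is a square mean completion of `E`: `H` is a square mean complete Archimedean vector
lattice, `φ : E → H` is an injective vector lattice homomorphism, and every vector lattice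
homomorphism from `E` to a square mean complete Archimedean vector lattice `F` factors uniquely
through `φ` by a vector lattice homomorphism `H → F`. -/
structure IsSquareMeanCompletion {E H : Type u}
    [AddCommGroup E] [Lattice E] [Module ℝ E]
    [AddCommGroup H] [Lattice H] [Module ℝ H] (φ : E →ₗ[ℝ] H) : Prop where
  archimedean : IsArchimedean H
  complete : IsSquareMeanComplete H
  hom : IsVectorLatticeHom φ
  injective : Function.Injective φ
  existsUnique_lift : ∀ (F : Type u) [AddCommGroup F] [Lattice F] [IsOrderedAddMonoid F]
    [Module ℝ F] [IsOrderedModule ℝ F], IsArchimedean F → IsSquareMeanComplete F →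
    ∀ T : E →ₗ[ℝ] F, IsVectorLatticeHom T →
      ∃! S : H →ₗ[ℝ] F, IsVectorLatticeHom S ∧ S ∘ₗ φ = T

/-- Relatively uniform convergence of a sequence: there is a regulator `u ≥ 0` such that for every
`ε > 0` one has `|a n - f| ≤ ε u` for all large `n`. -/
def RelUniformTendsto {E : Type*} [AddCommGroup E] [Lattice E] [Module ℝ E]
    (a : ℕ → E) (f : E) : Prop :=
  ∃ u : E, 0 ≤ u ∧ ∀ ε : ℝ, 0 < ε → ∃ N : ℕ, ∀ n : ℕ, N ≤ n → |a n - f| ≤ ε • u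

/-- The pseudo uniform closure of `A`: the limits of relatively uniformly convergent sequences
in `A`. -/
def pseudoUniformClosure {E : Type*} [AddCommGroup E] [Lattice E] [Module ℝ E]
    (A : Set E) : Set E :=
  {f | ∃ a : ℕ → E, (∀ n, a n ∈ A) ∧ RelUniformTendsto a f}

/-- `A` is relatively uniformly dense in `E` if its pseudo uniform closure is all of `E`. -/
def IsRelUniformlyDense {E : Type*} [AddCommGroup E] [Lattice E] [Module ℝ E]
    (A : Set E) : Prop :=
  pseudoUniformClosure A = Set.univ

end VectorLattice

namespace VectorLattice

section Basic

variable {E : Type*} [AddCommGroup E] [Lattice E] [IsOrderedAddMonoid E] [Module ℝ E]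

/-! Let `A` be the pseudo uniform closure of `φ(E)` in `H`. It is a vector sublattice, and it is
closed under `⊞` (`IsBoxPlus.mem_pseudoUniformClosure`), so it is itself square mean complete and
Archimedean. The universal property then extends `φ : E → A` to `S : H → A`. Followed by the
inclusion, `S` is an endomorphism of `H` fixing `φ(E)`, hence the identity by uniqueness, so `A = H`
(`IsSquareMeanCompletion.eq_top`). Closure under `⊞` is shown by refining the net of angles along
with the approximants of `f` and `g`. One sequence from `φ(E)` then suffices, so the closure need
not be iterated. -/

lemma RelUniformTendsto.add {a b : ℕ → E} {f g : E} (ha : RelUniformTendsto a f)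
    (hb : RelUniformTendsto b g) : RelUniformTendsto (fun n => a n + b n) (f + g) := by
  obtain ⟨u, hu, ha⟩ := ha
  obtain ⟨v, hv, hb⟩ := hb
  refine ⟨u + v, add_nonneg hu hv, fun ε hε => ?_⟩
  obtain ⟨N, hN⟩ := ha ε hε
  obtain ⟨M, hM⟩ := hb ε hε
  refine ⟨max N M, fun n hn => ?_⟩
  rw [add_sub_add_comm, smul_add]
  exact (abs_add_le _ _).trans
    (add_le_add (hN n (le_of_max_le_left hn)) (hM n (le_of_max_le_right hn)))

lemma RelUniformTendsto.abs {a : ℕ → E} {f : E} (ha : RelUniformTendsto a f) :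
    RelUniformTendsto (fun n => |a n|) |f| := by
  obtain ⟨u, hu, ha⟩ := ha
  refine ⟨u, hu, fun ε hε => ?_⟩
  obtain ⟨N, hN⟩ := ha ε hε
  exact ⟨N, fun n hn => (abs_abs_sub_abs_le _ _).trans (hN n hn)⟩

lemma subset_pseudoUniformClosure (A : Set E) : A ⊆ pseudoUniformClosure A := by
  intro f hf
  refine ⟨fun _ => f, fun _ => hf, 0, le_rfl, fun ε _ => ⟨0, fun n _ => ?_⟩⟩
  simp

lemma sup_mem_of_abs_mem {A : Submodule ℝ E} (hA : ∀ f ∈ A, |f| ∈ A) {f g : E} (hf : f ∈ A)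
    (hg : g ∈ A) : f ⊔ g ∈ A := by
  rw [sup_eq_half_smul_add_add_abs_sub' ℝ]
  exact A.smul_mem _ (A.add_mem (A.add_mem hf hg) (hA _ (A.sub_mem hg hf)))

lemma inf_mem_of_abs_mem {A : Submodule ℝ E} (hA : ∀ f ∈ A, |f| ∈ A) {f g : E} (hf : f ∈ A)
    (hg : g ∈ A) : f ⊓ g ∈ A := by
  rw [inf_eq_half_smul_add_sub_abs_sub' ℝ]
  exact A.smul_mem _ (A.sub_mem (A.add_mem hf hg) (hA _ (A.sub_mem hg hf)))

/-- A linear subspace closed under absolute values is a lattice for the induced order. -/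
abbrev sublatticeOfAbsMem (A : Submodule ℝ E) (hA : ∀ f ∈ A, |f| ∈ A) : Lattice A :=
  Subtype.lattice (fun _ _ hf hg => sup_mem_of_abs_mem hA hf hg)
    (fun _ _ hf hg => inf_mem_of_abs_mem hA hf hg)

lemma IsArchimedean.sublattice (hE : IsArchimedean E) {A : Submodule ℝ E}
    (hA : ∀ f ∈ A, |f| ∈ A) :
    letI := sublatticeOfAbsMem A hA
    IsArchimedean A :=
  fun f g h => Subtype.ext (hE f g fun n => h n)

/-- The supremum taken in `E` lies in `A`, and every upper bound in `A` is one in `E`, so it is also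
the supremum in `A`. -/
lemma IsSquareMeanComplete.sublattice (hE : IsSquareMeanComplete E) {A : Submodule ℝ E}
    (hA : ∀ f ∈ A, |f| ∈ A) (hbox : ∀ f ∈ A, ∀ g ∈ A, ∀ k, IsBoxPlus f g k → k ∈ A) :
    letI := sublatticeOfAbsMem A hA
    IsSquareMeanComplete A := by
  intro f g
  obtain ⟨-, k, hk, -⟩ := hE (f : E) (g : E)
  refine ⟨_, ⟨k, hbox f f.2 g g.2 k hk⟩, ⟨?_, ?_⟩, rfl⟩
  · rintro _ ⟨θ, hθ, rfl⟩
    exact hk.1 ⟨θ, hθ, rfl⟩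
  · intro m hm
    refine hk.2 (?_ : (m : E) ∈ _)
    rintro _ ⟨θ, hθ, rfl⟩
    exact hm ⟨θ, hθ, rfl⟩

variable [IsOrderedModule ℝ E]

lemma smul_le_smul_of_abs_le {c δ : ℝ} {x y : E} (hc : |c| ≤ δ) (hx : |x| ≤ y) :
    c • x ≤ δ • y := by
  have hle : c • x ≤ |c| • |x| := by
    rcases le_total 0 c with h | h
    · rw [abs_of_nonneg h]
      exact smul_le_smul_of_nonneg_left (le_abs_self x) h
    · rw [abs_of_nonpos h, ← neg_smul_neg c x]
      exact smul_le_smul_of_nonneg_left (neg_le_abs x) (neg_nonneg.2 h)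
  exact hle.trans <| (smul_le_smul_of_nonneg_left hx (abs_nonneg c)).trans <|
    smul_le_smul_of_nonneg_right hc ((abs_nonneg x).trans hx)

lemma abs_smul_le_smul {c δ : ℝ} {x y : E} (hc : |c| ≤ δ) (hx : |x| ≤ y) :
    |c • x| ≤ δ • y := by
  refine sup_le (smul_le_smul_of_abs_le hc hx) ?_
  rw [← neg_smul]
  exact smul_le_smul_of_abs_le (by rwa [abs_neg]) hx

lemma RelUniformTendsto.const_smul {a : ℕ → E} {f : E} (c : ℝ) (ha : RelUniformTendsto a f) :
    RelUniformTendsto (fun n => c • a n) (c • f) := by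
  obtain ⟨u, hu, ha⟩ := ha
  refine ⟨|c| • u, smul_nonneg (abs_nonneg c) hu, fun ε hε => ?_⟩
  obtain ⟨N, hN⟩ := ha ε hε
  refine ⟨N, fun n hn => ?_⟩
  rw [← smul_sub, smul_comm]
  exact abs_smul_le_smul le_rfl (hN n hn)

/-- The pseudo uniform closure of a linear subspace, as a linear subspace. -/
def pseudoUniformClosureSubmodule (A : Submodule ℝ E) : Submodule ℝ E where
  carrier := pseudoUniformClosure (A : Set E)
  zero_mem' := subset_pseudoUniformClosure _ A.zero_mem
  add_mem' := by
    rintro f g ⟨a, haA, ha⟩ ⟨b, hbA, hb⟩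
    exact ⟨_, fun n => A.add_mem (haA n) (hbA n), ha.add hb⟩
  smul_mem' := by
    rintro c f ⟨a, haA, ha⟩
    exact ⟨_, fun n => A.smul_mem c (haA n), ha.const_smul c⟩

lemma abs_mem_pseudoUniformClosureSubmodule {A : Submodule ℝ E} (hA : ∀ f ∈ A, |f| ∈ A) :
    ∀ f ∈ pseudoUniformClosureSubmodule A, |f| ∈ pseudoUniformClosureSubmodule A := by
  rintro f ⟨a, haA, ha⟩
  exact ⟨_, fun n => hA _ (haA n), ha.abs⟩

lemma exists_finset_net {δ : ℝ} (hδ : 0 < δ) :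
    ∃ t : Finset ℝ, t.Nonempty ∧ (t : Set ℝ) ⊆ Set.Icc 0 (2 * Real.pi) ∧
      ∀ θ ∈ Set.Icc 0 (2 * Real.pi), ∃ s ∈ t, |θ - s| ≤ δ := by
  obtain ⟨t, hts, hfin, ht⟩ :=
    finite_cover_balls_of_compact (isCompact_Icc (a := (0 : ℝ)) (b := 2 * Real.pi)) hδ
  have hnet : ∀ θ ∈ Set.Icc 0 (2 * Real.pi), ∃ s ∈ hfin.toFinset, |θ - s| ≤ δ := by
    intro θ hθ
    obtain ⟨s, hs, hθs⟩ := Set.mem_iUnion₂.1 (ht hθ)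
    exact ⟨s, hfin.mem_toFinset.2 hs, (Metric.mem_ball.1 hθs).le⟩
  obtain ⟨s, hs, -⟩ := hnet 0 ⟨le_rfl, Real.two_pi_pos.le⟩
  exact ⟨hfin.toFinset, ⟨s, hs⟩, by simpa using hts, hnet⟩

lemma cos_smul_add_sin_smul_le {f g a b x y : E} (θ : ℝ) (ha : |f - a| ≤ x) (hb : |g - b| ≤ y) :
    Real.cos θ • f + Real.sin θ • g ≤ Real.cos θ • a + Real.sin θ • b + (x + y) := by
  have h₁ := smul_le_smul_of_abs_le (Real.abs_cos_le_one θ) ha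
  have h₂ := smul_le_smul_of_abs_le (Real.abs_sin_le_one θ) hb
  rw [one_smul, smul_sub, sub_le_iff_le_add'] at h₁ h₂
  rw [add_add_add_comm]
  exact add_le_add h₁ h₂

/-- Cosine and sine are 1-Lipschitz; this is the price of moving an angle to a nearby point of the
net. -/
lemma cos_smul_add_sin_smul_le_of_abs_sub_le {δ θ s : ℝ} (f g : E) (h : |θ - s| ≤ δ) :
    Real.cos θ • f + Real.sin θ • g ≤
      Real.cos s • f + Real.sin s • g + δ • (|f| + |g|) := by
  have h₁ := smul_le_smul_of_abs_le ((Real.abs_cos_sub_cos_le θ s).trans h) (le_refl |f|)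
  have h₂ := smul_le_smul_of_abs_le ((Real.abs_sin_sub_sin_le θ s).trans h) (le_refl |g|)
  rw [sub_smul, sub_le_iff_le_add'] at h₁ h₂
  rw [smul_add, add_add_add_comm]
  exact add_le_add h₁ h₂

/-- The pseudo uniform closure of a vector sublattice is closed under `⊞`: finite suprema over
finer and finer nets of angles converge relatively uniformly. -/
lemma IsBoxPlus.mem_pseudoUniformClosure {A : Submodule ℝ E} (hA : ∀ f ∈ A, |f| ∈ A) {f g k : E}
    (hf : f ∈ pseudoUniformClosure (A : Set E)) (hg : g ∈ pseudoUniformClosure (A : Set E))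
    (hk : IsBoxPlus f g k) : k ∈ pseudoUniformClosure (A : Set E) := by
  obtain ⟨a, haA, u, hu, ha⟩ := hf
  obtain ⟨b, hbA, v, hv, hb⟩ := hg
  choose t htne htsub htnet using
    fun n : ℕ => exists_finset_net (Nat.one_div_pos_of_nat (α := ℝ) (n := n))
  refine ⟨fun n => (t n).sup' (htne n) fun s => Real.cos s • a n + Real.sin s • b n,
    fun n => Finset.sup'_mem (A : Set E) (fun x hx y hy => sup_mem_of_abs_mem hA hx hy) _ _ _
      fun s _ => A.add_mem (A.smul_mem _ (haA n)) (A.smul_mem _ (hbA n)),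
    -- In the regulator, `|f| + |g|` absorbs the mesh `1 / (n + 1)` of the net, and `u + v` the
    -- errors of `a n` and `b n`.
    (|f| + |g|) + (u + v), by positivity, fun ε hε => ?_⟩
  obtain ⟨N₁, hN₁⟩ := ha ε hε
  obtain ⟨N₂, hN₂⟩ := hb ε hε
  obtain ⟨N₃, hN₃⟩ := exists_nat_one_div_lt hε
  refine ⟨max N₁ (max N₂ N₃), fun n hn => ?_⟩
  simp only [max_le_iff] at hn
  have han := hN₁ n hn.1
  have hbn := hN₂ n hn.2.1
  have hδ : 1 / ((n : ℝ) + 1) ≤ ε := (Nat.one_div_le_one_div hn.2.2).trans hN₃.le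
  have hfg : 0 ≤ |f| + |g| := add_nonneg (abs_nonneg f) (abs_nonneg g)
  refine sup_le ?_ ?_
  · rw [sub_le_iff_le_add']
    refine Finset.sup'_le _ _ fun s hs => (cos_smul_add_sin_smul_le s han hbn).trans ?_
    rw [← smul_add]
    exact add_le_add (hk.1 ⟨s, htsub n hs, rfl⟩)
      (smul_le_smul_of_nonneg_left (le_add_of_nonneg_left hfg) hε.le)
  · rw [neg_sub, sub_le_iff_le_add']
    refine hk.2 ?_
    rintro _ ⟨θ, hθ, rfl⟩
    obtain ⟨s, hs, hθs⟩ := htnet n θ hθ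
    -- The roles swap: here `f`, `g` are bounded through `a n`, `b n`, at the net point `s` near
    -- `θ`.
    rw [abs_sub_comm] at han hbn
    have h₁ := cos_smul_add_sin_smul_le_of_abs_sub_le f g (hθs.trans hδ)
    have h₂ := cos_smul_add_sin_smul_le s han hbn
    have h₃ := Finset.le_sup' (fun s => Real.cos s • a n + Real.sin s • b n) hs
    calc _ ≤ _ := h₁
      _ ≤ _ := add_le_add_left (h₂.trans (add_le_add_left h₃ _)) _
      _ = _ := by rw [add_assoc, ← smul_add, ← smul_add, add_comm (u + v)]

end Basic

/-- A vector sublattice of a square mean completion which contains the original vector lattice and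
is closed under `⊞` is the whole completion. -/
lemma IsSquareMeanCompletion.eq_top {E H : Type u} [AddCommGroup E] [Lattice E] [Module ℝ E]
    [AddCommGroup H] [Lattice H] [IsOrderedAddMonoid H] [Module ℝ H] [IsOrderedModule ℝ H]
    {φ : E →ₗ[ℝ] H} (hφ : IsSquareMeanCompletion φ) {A : Submodule ℝ H}
    (hA : ∀ f ∈ A, |f| ∈ A) (hbox : ∀ f ∈ A, ∀ g ∈ A, ∀ k, IsBoxPlus f g k → k ∈ A)
    (hφA : ∀ f, φ f ∈ A) : A = ⊤ := by
  let : Lattice A := sublatticeOfAbsMem A hA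
  have : IsOrderedAddMonoid A :=
    { add_le_add_left := fun f g h k => add_le_add_left (α := H) h k }
  have : IsOrderedModule ℝ A :=
    { smul_le_smul_of_nonneg_left := fun c hc f g h =>
        smul_le_smul_of_nonneg_left (β := H) h hc
      smul_le_smul_of_nonneg_right := fun f hf c d h =>
        smul_le_smul_of_nonneg_right (β := H) h hf }
  obtain ⟨S, ⟨hS, hSφ⟩, -⟩ := hφ.existsUnique_lift A (hφ.archimedean.sublattice hA)
    (hφ.complete.sublattice hA hbox) (φ.codRestrict A hφA)
    fun f => Subtype.ext (hφ.hom f)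
  -- Both sides are vector lattice homomorphisms `H → H` that extend `φ`.
  have hid : A.subtype ∘ₗ S = LinearMap.id :=
    (hφ.existsUnique_lift H hφ.archimedean hφ.complete φ hφ.hom).unique
      ⟨fun f => congrArg Subtype.val (hS f),
        by rw [LinearMap.comp_assoc, hSφ, LinearMap.subtype_comp_codRestrict]⟩
      ⟨fun _ => rfl, LinearMap.id_comp φ⟩
  refine (Submodule.eq_top_iff').2 fun f => ?_
  rw [← LinearMap.id_apply (R := ℝ) f, ← hid]
  exact (S f).2

end VectorLattice

theorem proposition4p6 (E : Type u)
    [AddCommGroup E] [Lattice E] [IsOrderedAddMonoid E] [Module ℝ E] [IsOrderedModule ℝ E]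
    (hE : VectorLattice.IsArchimedean E)
    (H : Type u)
    [AddCommGroup H] [Lattice H] [IsOrderedAddMonoid H] [Module ℝ H] [IsOrderedModule ℝ H]
    (φ : E →ₗ[ℝ] H) (hφ : VectorLattice.IsSquareMeanCompletion φ) :
    VectorLattice.IsRelUniformlyDense (Set.range φ) := by
  have hA : ∀ f ∈ LinearMap.range φ, |f| ∈ LinearMap.range φ := by
    rintro _ ⟨f, rfl⟩
    exact ⟨|f|, hφ.hom f⟩
  have htop := hφ.eq_top (A := VectorLattice.pseudoUniformClosureSubmodule (LinearMap.range φ))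
    (VectorLattice.abs_mem_pseudoUniformClosureSubmodule hA)
    (fun _ hf _ hg _ hk => hk.mem_pseudoUniformClosure hA hf hg)
    (fun f => VectorLattice.subset_pseudoUniformClosure _ (LinearMap.mem_range_self φ f))
  have h := congrArg (fun A : Submodule ℝ H => (A : Set H)) htop
  rwa [Submodule.top_coe] at h
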